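/- Let $d\ge 2$, let $\Omega\subset\mathbb{R}^d$ be a bounded domain (connected open set), let $m\ge 1$, and let $Q_1,\dots,Q_m\in\partial\Omega$ be fixed distinct points. Let $(P_i)_{i\ge 1}$ be a sequence of i.i.d. random points in $\Omega$ distributed according to a probability density $\sigma\in L^1_+(\Omega)$. For $\varepsilon>0$, $n\ge 0$ and $\phi:[0,\infty)\to\mathbb{R}$ put $\phi_j(P)=\phi(\varepsilon\|P-P_j\|_2)$ for $1\le j\le n$ and $\psi_k(P)=\phi(\varepsilon\|P-Q_k\|_2)$ for $1\le k\le m$. The Kansa collocation matrix for the Dirichlet problem $\Delta u=f$ in $\Omega$, $u=g$ on $\partial\Omega$, is the $(n+m)\times(n+m)$ matrix $$ K_n=\begin{pmatrix}(\Delta\phi_j(P_i)) & (\Delta\psi_k(P_i))\\ (\phi_j(Q_h)) & (\psi_k(Q_h))\end{pmatrix},\qquad 1\le i,j\le n,\quad 1\le h,k\le m, $$ where $\Delta=\partial^2/\partial x_1^2+\dots+\partial^2/\partial x_d^2$. Then, for every $\varepsilon>0$ and every $n\ge 0$, the matrix $K_n$ is almost surely nonsingular in each of the following cases: - (Gaussian)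 $\phi(r)=e^{-r^2}$; - (Generalized Inverse MultiQuadric) $\phi(r)=(1+r^2)^\beta$ with any $\beta<0$; - (Matérn) $\phi(r)=\frac{2^{1-\nu}}{\Gamma(\nu)}\,r^\nu K_\nu(r)$ for $r>0$ and $\phi(0)=1$ (its limit as $r\to 0^+$), with any $\nu>1$, where $K_\nu$ is the modified Bessel function of the second kind, $K_\nu(r)=\int_0^\infty e^{-r\cosh t}\cosh(\nu t)\,dt$ for $r>0$. -/

import Mathlib

open MeasureTheory ProbabilityTheory

noncomputable section

/-- The Gaussian radial function `φ(r) = exp(-r²)`. -/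
def gaussianRBF (r : ℝ) : ℝ := Real.exp (-r ^ 2)

/-- The generalized inverse multiquadric radial function `φ(r) = (1 + r²)^β`. -/
def gimqRBF (β r : ℝ) : ℝ := (1 + r ^ 2) ^ β

/-- The modified Bessel function of the second kind (Macdonald function) of real order `ν`, at
`r > 0`, by its standard integral `K_ν(r) = ∫_0^∞ exp(-r cosh t) cosh(ν t) dt`, which converges
absolutely for every `r > 0`. -/
def besselK (ν r : ℝ) : ℝ :=
  ∫ t in Set.Ioi (0 : ℝ), Real.exp (-r * Real.cosh t) * Real.cosh (ν * t)

/-- The Matérn radial function `φ(r) = 2^(1-ν) / Γ(ν) * r^ν * K_ν(r)` for `r > 0`, extended to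
`r = 0` by its limit `1`. -/
def maternRBF (ν r : ℝ) : ℝ :=
  if r = 0 then 1 else 2 ^ (1 - ν) / Real.Gamma ν * r ^ ν * besselK ν r

/-- The radial basis function `X ↦ φ(ε ‖X - A‖₂)` centred at `A ∈ ℝᵈ`, with shape parameter `ε`. -/
def rbf {d : ℕ} (φ : ℝ → ℝ) (ε : ℝ) (A X : EuclideanSpace ℝ (Fin d)) : ℝ :=
  φ (ε * ‖X - A‖)

/-- The (unsymmetric) Kansa collocation matrix of the Dirichlet problem for the Poisson equation,
with interior points `P i` and boundary points `Q h`. Its columns are indexed by the centres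
`P j`, `Q k`; the rows of the interior points carry the Laplacians of the basis functions, those
of the boundary points their values. -/
def kansaMatrix {d n m : ℕ} (φ : ℝ → ℝ) (ε : ℝ)
    (P : Fin n → EuclideanSpace ℝ (Fin d)) (Q : Fin m → EuclideanSpace ℝ (Fin d)) :
    Matrix (Fin n ⊕ Fin m) (Fin n ⊕ Fin m) ℝ :=
  Matrix.fromBlocks
    (Matrix.of fun i j => Laplacian.laplacian (rbf φ ε (P j)) (P i))
    (Matrix.of fun i k => Laplacian.laplacian (rbf φ ε (Q k)) (P i))
    (Matrix.of fun h j => rbf φ ε (P j) (Q h))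
    (Matrix.of fun h k => rbf φ ε (Q k) (Q h))

end

/-! Each of the three kernels is a Gaussian mixture `f(x) = ∫ exp(-‖x‖² X) dγ` with `γ` finite and
nonzero, `X > 0` and `X` integrable: `γ` is a Dirac mass for the Gaussian, a Gamma law for the other
two. From this come all the facts needed: `f` is strictly positive definite, `f` and `Δf` are real
analytic off the origin and vanish at infinity, and `Δf(0) = -2d ∫ X dγ ≠ 0`.

Add the random points one at a time. For `n = 0` the matrix is `f(Q h - Q k)`, nonsingular by
positive definiteness (`det_gaussianMixture_ne_zero`). Given a nonsingular matrix `K`, adjoin an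
interior point `x`, allowed to range over the whole space. As `x → ∞` the off-diagonal entries of
its row and column vanish, so the new determinant tends to `Δf(0) det K ≠ 0`. It is analytic in `x`
away from the old centres, hence on almost every line of a fixed direction it is analytic and not
identically zero, and Fubini makes its zero set Lebesgue-null
(`ae_det_collocationMatrix_cons_ne_zero`). Absolute continuity and independence do the rest. -/

/-! ### Laplace moments of a positive random variable. -/

section LaplaceMoment

open Filter Topology

/-- The `k`-th Laplace moment `∫ X^k exp(-s X) dμ`. -/
noncomputable def laplaceMoment {Ω : Type*} [MeasurableSpace Ω] (X : Ω → ℝ) (μ : Measure Ω)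
    (k : ℕ) (s : ℝ) : ℝ :=
  ∫ ω, X ω ^ k * Real.exp (-s * X ω) ∂μ

variable {Ω : Type*} [MeasurableSpace Ω] {X : Ω → ℝ} {μ : Measure Ω}

/-- The moment generating function converges on the whole negative half-line; Laplace moments are
its derivatives at `-s`, which gives their analyticity. -/
theorem neg_mem_interior_integrableExpSet [IsFiniteMeasure μ] (hXm : Measurable X)
    (hX : ∀ᵐ ω ∂μ, 0 < X ω) {s : ℝ} (hs : 0 < s) :
    -s ∈ interior (integrableExpSet X μ) := by
  refine mem_interior.2 ⟨Set.Iio 0, fun t ht => ?_, isOpen_Iio, by simpa using hs⟩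
  refine Integrable.mono' (integrable_const (1 : ℝ)) (by fun_prop) ?_
  filter_upwards [hX] with ω hω
  rw [Real.norm_eq_abs, Real.abs_exp, Real.exp_le_one_iff]
  exact mul_nonpos_of_nonpos_of_nonneg (le_of_lt ht) hω.le

theorem hasDerivAt_laplaceMoment [IsFiniteMeasure μ] (hXm : Measurable X)
    (hX : ∀ᵐ ω ∂μ, 0 < X ω) (k : ℕ) {s : ℝ} (hs : 0 < s) :
    HasDerivAt (laplaceMoment X μ k) (-laplaceMoment X μ (k + 1) s) s := by
  have h := hasDerivAt_integral_pow_mul_exp_real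
    (neg_mem_interior_integrableExpSet hXm hX hs) k
  simpa only [laplaceMoment, neg_smul, one_smul] using! h.scomp s (hasDerivAt_neg s)

theorem analyticAt_laplaceMoment [IsFiniteMeasure μ] (hXm : Measurable X)
    (hX : ∀ᵐ ω ∂μ, 0 < X ω) (k : ℕ) {s : ℝ} (hs : 0 < s) :
    AnalyticAt ℝ (laplaceMoment X μ k) s := by
  have h := (analyticAt_iteratedDeriv_mgf
    (neg_mem_interior_integrableExpSet hXm hX hs) k).fun_comp (analyticAt_id.neg)
  refine h.congr ?_
  filter_upwards [lt_mem_nhds hs] with t ht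
  exact iteratedDeriv_mgf (neg_mem_interior_integrableExpSet hXm hX ht) k

theorem measurable_laplaceMoment [SFinite μ] (hXm : Measurable X) (k : ℕ) :
    Measurable (laplaceMoment X μ k) := by
  have : Measurable (fun p : ℝ × Ω => X p.2 ^ k * Real.exp (-p.1 * X p.2)) := by fun_prop
  exact (this.stronglyMeasurable.integral_prod_right (ν := μ)).measurable

theorem exp_neg_mul_le_one {s x : ℝ} (hs : 0 ≤ s) (hx : 0 ≤ x) : Real.exp (-s * x) ≤ 1 := by
  rw [Real.exp_le_one_iff, neg_mul]
  exact neg_nonpos.2 (mul_nonneg hs hx)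

theorem norm_pow_mul_exp_le {s x : ℝ} (hs : 0 ≤ s) (hx : 0 ≤ x) (k : ℕ) :
    ‖x ^ k * Real.exp (-s * x)‖ ≤ x ^ k := by
  rw [Real.norm_of_nonneg (by positivity)]
  exact mul_le_of_le_one_right (by positivity) (exp_neg_mul_le_one hs hx)

theorem tendsto_laplaceMoment_atTop (hXm : Measurable X) (hX : ∀ᵐ ω ∂μ, 0 < X ω) {k : ℕ}
    (hk : Integrable (fun ω => X ω ^ k) μ) : Tendsto (laplaceMoment X μ k) atTop (𝓝 0) := by
  have : Tendsto (laplaceMoment X μ k) atTop (𝓝 (∫ _, (0 : ℝ) ∂μ)) := by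
    refine tendsto_integral_filter_of_dominated_convergence (fun ω => X ω ^ k)
      (Eventually.of_forall fun s => by fun_prop) ?_ hk ?_
    · filter_upwards [eventually_ge_atTop 0] with s hs
      filter_upwards [hX] with ω hω using norm_pow_mul_exp_le hs hω.le k
    · filter_upwards [hX] with ω hω
      rw [← mul_zero (X ω ^ k)]
      refine Tendsto.const_mul _ (Real.tendsto_exp_atBot.comp ?_)
      exact (tendsto_neg_atTop_atBot).atBot_mul_const hω
  simpa using this

/-- Since `y exp(-y) ≤ 1`, the integrand `X (s X exp(-s X))` is dominated by `X`, so no second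
moment is needed. -/
theorem tendsto_mul_laplaceMoment_atTop (hXm : Measurable X) (hX : ∀ᵐ ω ∂μ, 0 < X ω)
    (hXi : Integrable X μ) :
    Tendsto (fun s => s * laplaceMoment X μ 2 s) atTop (𝓝 0) := by
  have : Tendsto (fun s => ∫ ω, s * (X ω ^ 2 * Real.exp (-s * X ω)) ∂μ) atTop
      (𝓝 (∫ _, (0 : ℝ) ∂μ)) := by
    refine tendsto_integral_filter_of_dominated_convergence X
      (Eventually.of_forall fun s => by fun_prop) ?_ hXi ?_
    · filter_upwards [eventually_ge_atTop 0] with s hs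
      filter_upwards [hX] with ω hω
      rw [Real.norm_of_nonneg (by positivity)]
      have h1 : s * X ω * Real.exp (-s * X ω) ≤ 1 := by
        have := Real.add_one_le_exp (s * X ω)
        rw [neg_mul, Real.exp_neg, ← div_eq_mul_inv, div_le_one (Real.exp_pos _)]
        linarith
      calc _ = X ω * (s * X ω * Real.exp (-s * X ω)) := by ring
        _ ≤ X ω := mul_le_of_le_one_right hω.le h1
    · filter_upwards [hX] with ω hω
      have h := (Real.tendsto_pow_mul_exp_neg_atTop_nhds_zero 1).comp
        (tendsto_id.atTop_mul_const hω)
      have h2 := h.const_mul (X ω)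
      rw [mul_zero] at h2
      refine h2.congr fun s => ?_
      simp only [Function.comp, id, pow_one, neg_mul]
      ring
  simpa [laplaceMoment, integral_const_mul] using this

theorem tendsto_laplaceMoment_zero (hXm : Measurable X) (hX : ∀ᵐ ω ∂μ, 0 < X ω) {k : ℕ}
    (hk : Integrable (fun ω => X ω ^ k) μ) :
    Tendsto (laplaceMoment X μ k) (𝓝[≥] 0) (𝓝 (laplaceMoment X μ k 0)) := by
  refine tendsto_integral_filter_of_dominated_convergence (fun ω => X ω ^ k)
      (Eventually.of_forall fun s => by fun_prop) ?_ hk ?_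
  · filter_upwards [self_mem_nhdsWithin] with s hs
    filter_upwards [hX] with ω hω using norm_pow_mul_exp_le hs hω.le k
  · refine Eventually.of_forall fun ω => Tendsto.mono_left (Continuous.tendsto ?_ _) inf_le_left
    fun_prop

theorem laplaceMoment_one_zero_pos (hμ : μ ≠ 0) (hX : ∀ᵐ ω ∂μ, 0 < X ω)
    (hXi : Integrable X μ) : 0 < laplaceMoment X μ 1 0 := by
  have h : laplaceMoment X μ 1 0 = ∫ ω, X ω ∂μ := by simp [laplaceMoment]
  rw [h, integral_pos_iff_support_of_nonneg_ae (hX.mono fun _ h => h.le) hXi, pos_iff_ne_zero]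
  intro h0
  have : ∀ᵐ ω ∂μ, X ω = 0 := by
    rw [ae_iff]; exact h0
  exact hμ (ae_eq_bot.1 (eventually_false_iff_eq_bot.1
    ((hX.and this).mono fun ω h => h.1.ne' h.2)))

theorem integrable_exp_neg_mul [IsFiniteMeasure μ] (hXm : Measurable X)
    (hX : ∀ᵐ ω ∂μ, 0 < X ω) {s : ℝ} (hs : 0 ≤ s) :
    Integrable (fun ω => Real.exp (-s * X ω)) μ := by
  refine Integrable.mono' (integrable_const (1 : ℝ)) (by fun_prop) ?_
  filter_upwards [hX] with ω hω
  rw [Real.norm_of_nonneg (by positivity)]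
  exact exp_neg_mul_le_one hs hω.le

/-- With `s = ‖x‖²` this is a quadratic bound, which makes the mixture differentiable at the origin.
-/
theorem abs_laplaceMoment_zero_sub_le [IsFiniteMeasure μ] (hXm : Measurable X)
    (hX : ∀ᵐ ω ∂μ, 0 < X ω) (hXi : Integrable X μ) {s : ℝ} (hs : 0 ≤ s) :
    |laplaceMoment X μ 0 s - laplaceMoment X μ 0 0| ≤ (∫ ω, X ω ∂μ) * s := by
  have h0 := integrable_exp_neg_mul hXm hX le_rfl
  have h1 := integrable_exp_neg_mul hXm hX hs
  simp only [laplaceMoment, pow_zero, one_mul]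
  rw [← integral_sub h1 h0, ← integral_mul_const, ← Real.norm_eq_abs]
  refine norm_integral_le_of_norm_le (hXi.mul_const s) ?_
  filter_upwards [hX] with ω hω
  have h2 := exp_neg_mul_le_one hs hω.le
  have h3 := Real.add_one_le_exp (-s * X ω)
  rw [neg_zero, zero_mul, Real.exp_zero, Real.norm_eq_abs, abs_le]
  constructor <;> nlinarith

end LaplaceMoment

/-! ### Regularity, decay and Laplacian of Gaussian mixtures. -/

section RadialLaplace

open Filter Topology

variable {Ω : Type*} [MeasurableSpace Ω] {X : Ω → ℝ} {μ : Measure Ω}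
variable {E : Type*} [NormedAddCommGroup E]

/-- The Gaussian mixture `x ↦ ∫ exp(-‖x‖² X) dμ`. -/
noncomputable def gaussianMixture (X : Ω → ℝ) (μ : Measure Ω) (x : E) : ℝ :=
  laplaceMoment X μ 0 (‖x‖ ^ 2)

theorem continuousAt_laplaceMoment_one_norm_sq (hXm : Measurable X) (hX : ∀ᵐ ω ∂μ, 0 < X ω)
    (hXi : Integrable X μ) :
    ContinuousAt (fun x : E => laplaceMoment X μ 1 (‖x‖ ^ 2)) 0 := by
  have h := tendsto_laplaceMoment_zero hXm hX (k := 1) (by simpa using hXi)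
  rw [ContinuousAt, norm_zero, zero_pow two_ne_zero]
  refine h.comp (tendsto_nhdsWithin_iff.2 ⟨?_, Eventually.of_forall fun y => sq_nonneg ‖y‖⟩)
  exact Continuous.tendsto' (by fun_prop) _ _ (by simp)

theorem measurable_gaussianMixture [MeasurableSpace E] [BorelSpace E] [SFinite μ]
    (hXm : Measurable X) : Measurable (gaussianMixture X μ : E → ℝ) :=
  (measurable_laplaceMoment hXm 0).comp (by fun_prop)

theorem tendsto_norm_sq_cobounded :
    Tendsto (fun x : E => ‖x‖ ^ 2) (Bornology.cobounded E) atTop :=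
  (tendsto_pow_atTop two_ne_zero).comp tendsto_norm_cobounded_atTop

theorem tendsto_gaussianMixture_cobounded [IsFiniteMeasure μ] (hXm : Measurable X)
    (hX : ∀ᵐ ω ∂μ, 0 < X ω) :
    Tendsto (gaussianMixture X μ : E → ℝ) (Bornology.cobounded E) (𝓝 0) :=
  (tendsto_laplaceMoment_atTop hXm hX (by simp)).comp tendsto_norm_sq_cobounded

variable [InnerProductSpace ℝ E]

/-- Because `L` vanishes at the origin, continuity of `c` suffices. The gradient of the mixture has
this form, with a coefficient that need not be differentiable at `0` when `X` has no second moment.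
-/
theorem hasFDerivAt_smul_of_continuousAt {F : Type*} [NormedAddCommGroup F] [NormedSpace ℝ F]
    {c : E → ℝ} (L : E →L[ℝ] F) (hc : ContinuousAt c 0) :
    HasFDerivAt (fun x => c x • L x) (c 0 • L) 0 := by
  rw [hasFDerivAt_iff_isLittleO_nhds_zero]
  have h1 : (fun x => c x - c 0) =o[𝓝 0] (fun _ : E => (1 : ℝ)) := by
    rw [Asymptotics.isLittleO_one_iff]
    simpa using! hc.tendsto.sub_const (c 0)
  have h2 := h1.smul_isBigO (L.isBigO_id (𝓝 0))
  simp only [one_smul] at h2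
  refine h2.congr_left fun x => ?_
  simp [sub_smul]

theorem hasFDerivAt_gaussianMixture [IsFiniteMeasure μ] (hXm : Measurable X)
    (hX : ∀ᵐ ω ∂μ, 0 < X ω) (hXi : Integrable X μ) (x : E) :
    HasFDerivAt (gaussianMixture X μ)
      ((-2 * laplaceMoment X μ 1 (‖x‖ ^ 2)) • innerSL ℝ x) x := by
  by_cases hx : x = 0
  · subst hx
    have h : (fun y : E => gaussianMixture X μ y - gaussianMixture X μ (0 : E)) =O[𝓝 0]
        (fun y => ‖y - 0‖ ^ 2) := by
      refine Asymptotics.IsBigO.of_bound (∫ ω, X ω ∂μ) (Eventually.of_forall fun y => ?_)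
      have := abs_laplaceMoment_zero_sub_le hXm hX hXi (sq_nonneg ‖y‖)
      simpa [gaussianMixture] using this
    have h' := (h.hasFDerivAt one_lt_two : HasFDerivAt (𝕜 := ℝ) _ _ _).add_const
      (gaussianMixture X μ (0 : E))
    simpa using h'
  · have h := (hasDerivAt_laplaceMoment hXm hX 0
      (pow_pos (norm_pos_iff.2 hx) 2)).comp_hasFDerivAt x (hasStrictFDerivAt_norm_sq x).hasFDerivAt
    convert! h using 1
    ext v
    simp
    ring

theorem fderiv_fderiv_gaussianMixture [IsFiniteMeasure μ] (hXm : Measurable X)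
    (hX : ∀ᵐ ω ∂μ, 0 < X ω) (hXi : Integrable X μ) (x v : E) :
    fderiv ℝ (fderiv ℝ (gaussianMixture X μ)) x v v =
      4 * laplaceMoment X μ 2 (‖x‖ ^ 2) * inner ℝ x v ^ 2 -
        2 * laplaceMoment X μ 1 (‖x‖ ^ 2) * ‖v‖ ^ 2 := by
  obtain ⟨B, hB⟩ : ∃ B : E →L[ℝ] E →L[ℝ] ℝ, ∀ x, B x = innerSL ℝ x :=
    ⟨innerSL ℝ, fun _ => rfl⟩
  have hB' : ∀ x v, B x v = inner ℝ x v := fun x v => by rw [hB, innerSL_apply_apply]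
  have h1 : fderiv ℝ (gaussianMixture X μ (E := E)) =
      fun x => (-2 * laplaceMoment X μ 1 (‖x‖ ^ 2)) • B x :=
    funext fun x => by rw [hB]; exact (hasFDerivAt_gaussianMixture hXm hX hXi x).fderiv
  rw [h1]
  -- At the origin the second moment may be infinite, its integral then having the default value
  -- `0`; it is multiplied by `inner ℝ 0 v = 0` anyway.
  by_cases hx : x = 0
  · subst hx
    have hc := (continuousAt_laplaceMoment_one_norm_sq (E := E) hXm hX hXi).const_mul (-2)
    rw [(hasFDerivAt_smul_of_continuousAt B hc).fderiv]
    simp [hB']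
  · have h := (hasDerivAt_laplaceMoment hXm hX 1
      (pow_pos (norm_pos_iff.2 hx) 2)).comp_hasFDerivAt x (hasStrictFDerivAt_norm_sq x).hasFDerivAt
    have h2 := ((h.const_mul (-2)).smul B.hasFDerivAt).fderiv
    simp only [Function.comp_def, Pi.smul_def'] at h2
    rw [h2]
    simp [hB']
    ring

theorem laplacian_gaussianMixture [FiniteDimensional ℝ E] [IsFiniteMeasure μ]
    (hXm : Measurable X) (hX : ∀ᵐ ω ∂μ, 0 < X ω) (hXi : Integrable X μ) (x : E) :
    Laplacian.laplacian (gaussianMixture X μ : E → ℝ) x =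
      4 * (‖x‖ ^ 2 * laplaceMoment X μ 2 (‖x‖ ^ 2)) -
        2 * Module.finrank ℝ E * laplaceMoment X μ 1 (‖x‖ ^ 2) := by
  rw [InnerProductSpace.laplacian_eq_iteratedFDeriv_stdOrthonormalBasis]
  simp only [iteratedFDeriv_two_apply, Matrix.cons_val_zero, Matrix.cons_val_one,
    fderiv_fderiv_gaussianMixture hXm hX hXi, Finset.sum_sub_distrib, ← Finset.mul_sum,
    OrthonormalBasis.sum_sq_inner_left, OrthonormalBasis.norm_eq_one]
  simp
  ring

theorem analyticAt_gaussianMixture [IsFiniteMeasure μ] (hXm : Measurable X)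
    (hX : ∀ᵐ ω ∂μ, 0 < X ω) {x : E} (hx : x ≠ 0) :
    AnalyticAt ℝ (gaussianMixture X μ) x :=
  (analyticAt_laplaceMoment hXm hX 0 (pow_pos (norm_pos_iff.2 hx) 2)).fun_comp
    (f := fun y : E => ‖y‖ ^ 2) (contDiff_norm_sq ℝ).contDiffAt.analyticAt

theorem analyticAt_laplacian_gaussianMixture [FiniteDimensional ℝ E] [IsFiniteMeasure μ]
    (hXm : Measurable X) (hX : ∀ᵐ ω ∂μ, 0 < X ω) (hXi : Integrable X μ) {x : E} (hx : x ≠ 0) :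
    AnalyticAt ℝ (Laplacian.laplacian (gaussianMixture X μ : E → ℝ)) x := by
  have hn : AnalyticAt ℝ (fun y : E => ‖y‖ ^ 2) x :=
    (contDiff_norm_sq ℝ).contDiffAt.analyticAt
  have h (k : ℕ) : AnalyticAt ℝ (fun y : E => laplaceMoment X μ k (‖y‖ ^ 2)) x :=
    (analyticAt_laplaceMoment hXm hX k (pow_pos (norm_pos_iff.2 hx) 2)).fun_comp
      (f := fun y : E => ‖y‖ ^ 2) hn
  rw [funext (laplacian_gaussianMixture hXm hX hXi)]
  exact (analyticAt_const.mul (hn.mul (h 2))).sub (analyticAt_const.mul (h 1))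

theorem measurable_laplacian_gaussianMixture [FiniteDimensional ℝ E] [MeasurableSpace E]
    [BorelSpace E] [IsFiniteMeasure μ]
    (hXm : Measurable X) (hX : ∀ᵐ ω ∂μ, 0 < X ω) (hXi : Integrable X μ) :
    Measurable (Laplacian.laplacian (gaussianMixture X μ : E → ℝ)) := by
  have h (k : ℕ) : Measurable (fun y : E => laplaceMoment X μ k (‖y‖ ^ 2)) :=
    (measurable_laplaceMoment hXm k).comp (by fun_prop)
  rw [funext (laplacian_gaussianMixture hXm hX hXi)]
  exact (((measurable_norm.pow_const 2).mul (h 2)).const_mul 4).sub ((h 1).const_mul _)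

theorem tendsto_laplacian_gaussianMixture_cobounded [FiniteDimensional ℝ E] [IsFiniteMeasure μ]
    (hXm : Measurable X) (hX : ∀ᵐ ω ∂μ, 0 < X ω) (hXi : Integrable X μ) :
    Tendsto (Laplacian.laplacian (gaussianMixture X μ : E → ℝ)) (Bornology.cobounded E) (𝓝 0) := by
  rw [funext (laplacian_gaussianMixture hXm hX hXi)]
  have h1 := (tendsto_laplaceMoment_atTop hXm hX (k := 1) (by simpa using hXi)).comp
    (tendsto_norm_sq_cobounded (E := E))
  have h2 := (tendsto_mul_laplaceMoment_atTop hXm hX hXi).comp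
    (tendsto_norm_sq_cobounded (E := E))
  simpa [Function.comp_def] using
    (h2.const_mul 4).sub (h1.const_mul (2 * (Module.finrank ℝ E : ℝ)))

theorem laplacian_gaussianMixture_zero_ne [FiniteDimensional ℝ E] [Nontrivial E]
    [IsFiniteMeasure μ] (hμ : μ ≠ 0) (hXm : Measurable X) (hX : ∀ᵐ ω ∂μ, 0 < X ω)
    (hXi : Integrable X μ) : Laplacian.laplacian (gaussianMixture X μ : E → ℝ) 0 ≠ 0 := by
  have h := (laplaceMoment_one_zero_pos hμ hX hXi).ne'
  have hd := (Module.finrank_pos (R := ℝ) (M := E)).ne'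
  rw [laplacian_gaussianMixture hXm hX hXi]
  simp [h, hd]

end RadialLaplace

/-! ### Strict positive definiteness. -/

section StrictPositivity

open Filter Topology

variable {E : Type*} [NormedAddCommGroup E] [InnerProductSpace ℝ E]
variable {ι : Type*} [Fintype ι]

/-- Distinct exponentials are distinct characters of the additive group, hence linearly independent
(Dedekind). -/
theorem eq_zero_of_sum_mul_exp_inner_eq_zero {x : ι → E} (hx : Function.Injective x)
    {c : ι → ℝ} (h : ∀ z, ∑ i, c i * Real.exp (inner ℝ (x i) z) = 0) : c = 0 := by
  let χ : ι → Multiplicative E →* ℝ := fun i =>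
    { toFun := fun z => Real.exp (inner ℝ (x i) z.toAdd)
      map_one' := by simp
      map_mul' := fun a b => by simp [inner_add_right, Real.exp_add] }
  have hχ : Function.Injective χ := fun i j hij => hx (ext_inner_right ℝ fun z =>
    Real.exp_injective (DFunLike.congr_fun hij (Multiplicative.ofAdd z)))
  have hli := (linearIndependent_monoidHom (Multiplicative E) ℝ).comp χ hχ
  funext i
  refine Fintype.linearIndependent_iff.1 hli c ?_ i
  funext z
  simpa [χ, Finset.sum_apply] using h z.toAdd

variable [FiniteDimensional ℝ E]

theorem integral_exp_mul_exp [MeasurableSpace E] [BorelSpace E] {u : ℝ} (hu : 0 < u) (x y : E) :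
    (Integrable fun z : E => Real.exp (-(2 * u) * ‖z - x‖ ^ 2) * Real.exp (-(2 * u) * ‖z - y‖ ^ 2))
      ∧ ∫ z : E, Real.exp (-(2 * u) * ‖z - x‖ ^ 2) * Real.exp (-(2 * u) * ‖z - y‖ ^ 2) =
      (∫ z : E, Real.exp (-(4 * u) * ‖z‖ ^ 2)) * Real.exp (-u * ‖x - y‖ ^ 2) := by
  have key (z : E) : Real.exp (-(2 * u) * ‖z - x‖ ^ 2) * Real.exp (-(2 * u) * ‖z - y‖ ^ 2) =
      Real.exp (-(4 * u) * ‖z - (1 / 2 : ℝ) • (x + y)‖ ^ 2) * Real.exp (-u * ‖x - y‖ ^ 2) := by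
    rw [← Real.exp_add, ← Real.exp_add]
    congr 1
    simp only [← real_inner_self_eq_norm_sq, inner_sub_left, inner_sub_right, inner_add_left,
      inner_add_right, inner_smul_left, inner_smul_right, RCLike.conj_to_real,
      real_inner_comm x z, real_inner_comm y z, real_inner_comm y x]
    ring
  have hi : Integrable fun z : E => Real.exp (-(4 * u) * ‖z‖ ^ 2) := by
    have := (GaussianFourier.integrable_cexp_neg_mul_sq_norm_add (V := E) (b := (4 * u : ℝ))
      (by simpa using hu) 0 0).norm
    refine this.congr (Eventually.of_forall fun z => ?_)
    simp [Complex.norm_exp, ← Complex.ofReal_pow]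
  simp only [key]
  refine ⟨(hi.comp_sub_right _).mul_const _, ?_⟩
  rw [integral_mul_const, integral_sub_right_eq_self (fun z : E => Real.exp (-(4 * u) * ‖z‖ ^ 2))]

/-- Up to the factor `C`, the Gaussian matrix is the Gram matrix in `L²` of the narrower Gaussians
centred at the `x i`, so the form is `∫ g²`, and `g` is not identically zero. -/
theorem gaussian_quadraticForm_pos {u : ℝ} (hu : 0 < u) {x : ι → E}
    (hx : Function.Injective x) {c : ι → ℝ} (hc : c ≠ 0) :
    0 < ∑ i, ∑ j, c i * c j * Real.exp (-u * ‖x i - x j‖ ^ 2) := by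
  borelize E
  set C := ∫ z : E, Real.exp (-(4 * u) * ‖z‖ ^ 2) with hC
  have hC0 : 0 ≤ C := integral_nonneg fun z => (Real.exp_pos _).le
  let g : E → ℝ := fun z => ∑ i, c i * Real.exp (-(2 * u) * ‖z - x i‖ ^ 2)
  have hg2 (z : E) : g z ^ 2 = ∑ i, ∑ j, c i * c j *
      (Real.exp (-(2 * u) * ‖z - x i‖ ^ 2) * Real.exp (-(2 * u) * ‖z - x j‖ ^ 2)) := by
    simp only [g, sq (∑ i, _), Finset.sum_mul_sum]
    exact Finset.sum_congr rfl fun i _ => Finset.sum_congr rfl fun j _ => by ring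
  have hi (i j : ι) := (integral_exp_mul_exp hu (x i) (x j)).1.const_mul (c i * c j)
  have hgi : Integrable fun z => g z ^ 2 := by
    simp only [hg2]
    exact integrable_finsetSum _ fun i _ => integrable_finsetSum _ fun j _ => hi i j
  have hint : ∫ z, g z ^ 2 = C * ∑ i, ∑ j, c i * c j * Real.exp (-u * ‖x i - x j‖ ^ 2) := by
    simp only [hg2]
    rw [integral_finsetSum _ fun i _ => integrable_finsetSum _ fun j _ => hi i j, Finset.mul_sum]
    refine Finset.sum_congr rfl fun i _ => ?_
    rw [integral_finsetSum _ fun j _ => hi i j, Finset.mul_sum]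
    refine Finset.sum_congr rfl fun j _ => ?_
    rw [integral_const_mul, (integral_exp_mul_exp hu (x i) (x j)).2]
    ring
  have hpos : 0 < ∫ z, g z ^ 2 := by
    have hcont : Continuous fun z => g z ^ 2 := by fun_prop
    rw [integral_pos_iff_support_of_nonneg (fun z => sq_nonneg _) hgi]
    refine hcont.isOpen_support.measure_pos _ ?_
    by_contra hempty
    rw [Set.not_nonempty_iff_eq_empty, Function.support_eq_empty_iff] at hempty
    -- Expanding the square and removing the common factor `exp(-2u ‖z‖²)` turns `g` into a
    -- combination of exponentials with frequencies `4u x i`.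
    have hzero : (fun i => c i * Real.exp (-(2 * u) * ‖x i‖ ^ 2)) = 0 := by
      refine eq_zero_of_sum_mul_exp_inner_eq_zero (x := fun i => (4 * u) • x i)
        (fun i j hij => hx (smul_right_injective E (by positivity : (4 * u) ≠ 0) hij)) fun z => ?_
      have h0 : g z = 0 := pow_eq_zero_iff two_ne_zero |>.1 (congrFun hempty z)
      have : g z = Real.exp (-(2 * u) * ‖z‖ ^ 2) * ∑ i, c i * Real.exp (-(2 * u) * ‖x i‖ ^ 2) *
          Real.exp (inner ℝ ((4 * u) • x i) z) := by
        rw [Finset.mul_sum]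
        refine Finset.sum_congr rfl fun i _ => ?_
        have : Real.exp (-(2 * u) * ‖z - x i‖ ^ 2) = Real.exp (-(2 * u) * ‖z‖ ^ 2) *
            Real.exp (-(2 * u) * ‖x i‖ ^ 2) * Real.exp (inner ℝ ((4 * u) • x i) z) := by
          rw [← Real.exp_add, ← Real.exp_add, norm_sub_sq_real, real_inner_smul_left,
            real_inner_comm]
          congr 1
          ring
        rw [this]
        ring
      rw [this] at h0
      exact (mul_eq_zero.1 h0).resolve_left (Real.exp_ne_zero _)
    refine hc (funext fun i => ?_)
    exact (mul_eq_zero.1 (congrFun hzero i)).resolve_right (Real.exp_ne_zero _)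
  rw [hint] at hpos
  exact pos_of_mul_pos_right hpos hC0

variable {Ω : Type*} [MeasurableSpace Ω] {X : Ω → ℝ} {μ : Measure Ω}

theorem gaussianMixture_quadraticForm_pos [IsFiniteMeasure μ] (hμ : μ ≠ 0) (hXm : Measurable X)
    (hX : ∀ᵐ ω ∂μ, 0 < X ω) {x : ι → E} (hx : Function.Injective x) {c : ι → ℝ} (hc : c ≠ 0) :
    0 < ∑ i, ∑ j, c i * c j * gaussianMixture X μ (x i - x j) := by
  have hi (i j : ι) : Integrable
      (fun ω => c i * c j * Real.exp (-X ω * ‖x i - x j‖ ^ 2)) μ := by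
    refine Integrable.const_mul ?_ _
    refine (integrable_exp_neg_mul hXm hX (sq_nonneg ‖x i - x j‖)).congr
      (Eventually.of_forall fun ω => ?_)
    simp only [neg_mul, mul_comm (X ω)]
  have hint : ∑ i, ∑ j, c i * c j * gaussianMixture X μ (x i - x j) =
      ∫ ω, ∑ i, ∑ j, c i * c j * Real.exp (-X ω * ‖x i - x j‖ ^ 2) ∂μ := by
    rw [integral_finsetSum _ fun i _ => integrable_finsetSum _ fun j _ => hi i j]
    refine Finset.sum_congr rfl fun i _ => ?_
    rw [integral_finsetSum _ fun j _ => hi i j]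
    refine Finset.sum_congr rfl fun j _ => ?_
    rw [integral_const_mul]
    simp only [gaussianMixture, laplaceMoment, pow_zero, one_mul, neg_mul,
      mul_comm (‖x i - x j‖ ^ 2)]
  have hpos : ∀ᵐ ω ∂μ, 0 < ∑ i, ∑ j, c i * c j * Real.exp (-X ω * ‖x i - x j‖ ^ 2) :=
    hX.mono fun ω hω => gaussian_quadraticForm_pos hω hx hc
  rw [hint, integral_pos_iff_support_of_nonneg_ae (hpos.mono fun _ h => h.le)
    (integrable_finsetSum _ fun i _ => integrable_finsetSum _ fun j _ => hi i j), pos_iff_ne_zero]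
  intro h0
  have h0' : ∀ᵐ ω ∂μ, ∑ i, ∑ j, c i * c j * Real.exp (-X ω * ‖x i - x j‖ ^ 2) = 0 := by
    rw [ae_iff]; exact h0
  exact hμ (ae_eq_bot.1 (eventually_false_iff_eq_bot.1
    ((hpos.and h0').mono fun ω h => h.1.ne' h.2)))

theorem det_gaussianMixture_ne_zero [DecidableEq ι] [IsFiniteMeasure μ] (hμ : μ ≠ 0)
    (hXm : Measurable X) (hX : ∀ᵐ ω ∂μ, 0 < X ω) {x : ι → E} (hx : Function.Injective x) :
    (Matrix.of fun i j => gaussianMixture X μ (x i - x j)).det ≠ 0 := by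
  intro h0
  obtain ⟨c, hc, hAc⟩ := Matrix.exists_mulVec_eq_zero_iff.2 h0
  have h := gaussianMixture_quadraticForm_pos hμ hXm hX hx hc
  refine h.ne' (Finset.sum_eq_zero fun i _ => ?_)
  have := congrFun hAc i
  simp only [Matrix.mulVec, dotProduct, Matrix.of_apply, Pi.zero_apply] at this
  rw [← mul_zero (c i), ← this, Finset.mul_sum]
  exact Finset.sum_congr rfl fun j _ => by ring

end StrictPositivity

/-! ### Almost sure nonsingularity by induction on the points. -/

section Collocation

open Filter Topology

variable {E : Type*} [NormedAddCommGroup E]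

/-- The collocation matrix whose rows are given by `g` at the points `p`, by `f` at the
points `Q`. -/
def collocationMatrix {ι κ : Type*} (f g : E → ℝ) (p : ι → E) (Q : κ → E) :
    Matrix (ι ⊕ κ) (ι ⊕ κ) ℝ :=
  Matrix.of fun a b => Sum.elim (fun i => g (p i - Sum.elim p Q b))
    (fun h => f (Q h - Sum.elim p Q b)) a

/-- Splitting off the first of the points. -/
def finSuccSumEquiv (n : ℕ) (κ : Type*) : Unit ⊕ (Fin n ⊕ κ) ≃ Fin (n + 1) ⊕ κ where
  toFun := Sum.elim (fun _ => Sum.inl 0) (Sum.map Fin.succ id)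
  invFun := Sum.elim (Fin.cases (Sum.inl ()) fun i => Sum.inr (Sum.inl i))
    fun h => Sum.inr (Sum.inr h)
  left_inv := by rintro (_ | _ | _) <;> rfl
  right_inv := by
    rintro (i | _)
    · refine Fin.cases ?_ (fun i => ?_) i <;> rfl
    · rfl

variable {n : ℕ} {κ : Type*} [Fintype κ] [DecidableEq κ]

/-- Isolates the dependence on `x`. The corner is the constant `g 0`, so the possible singularity of
`g` at `0` does no harm there. -/
theorem det_collocationMatrix_cons (f g : E → ℝ) (x : E) (p : Fin n → E) (Q : κ → E) :
    (collocationMatrix f g (Fin.cons x p : Fin (n + 1) → E) Q).det =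
      (Matrix.fromBlocks (Matrix.of fun (_ _ : Unit) => g 0)
        (Matrix.of fun _ b => g (x - Sum.elim p Q b))
        (Matrix.of fun a _ => Sum.elim (fun i => g (p i - x)) (fun h => f (Q h - x)) a)
        (collocationMatrix f g p Q)).det := by
  rw [← Matrix.det_submatrix_equiv_self (finSuccSumEquiv n κ)]
  congr 1
  ext (_ | _ | _) (_ | _ | _) <;> simp [collocationMatrix, finSuccSumEquiv]

variable {f g : E → ℝ} {Q : κ → E}

theorem tendsto_det_collocationMatrix_cons
    (hfl : Tendsto f (Bornology.cobounded E) (𝓝 0))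
    (hgl : Tendsto g (Bornology.cobounded E) (𝓝 0)) (p : Fin n → E) :
    Tendsto (fun x => (collocationMatrix f g (Fin.cons x p : Fin (n + 1) → E) Q).det)
      (Bornology.cobounded E) (𝓝 (g 0 * (collocationMatrix f g p Q).det)) := by
  have h1 (a : E) : Tendsto (fun x => x - a) (Bornology.cobounded E) (Bornology.cobounded E) :=
    tendsto_sub_const_cobounded a
  have h2 (a : E) : Tendsto (fun x => a - x) (Bornology.cobounded E) (Bornology.cobounded E) :=
    tendsto_const_sub_cobounded a
  have hlim : g 0 * (collocationMatrix f g p Q).det =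
      (Matrix.fromBlocks (Matrix.of fun (_ _ : Unit) => g 0) 0 0
        (collocationMatrix f g p Q)).det := by
    simp
  simp only [hlim, det_collocationMatrix_cons]
  refine ((Continuous.matrix_det continuous_id).tendsto _).comp ?_
  refine tendsto_pi_nhds.2 fun a => tendsto_pi_nhds.2 fun b => ?_
  rcases a with a | a | a <;> rcases b with b | b
  · exact tendsto_const_nhds
  · exact hgl.comp (h1 _)
  · exact hgl.comp (h2 _)
  · exact tendsto_const_nhds
  · exact hfl.comp (h2 _)
  · exact tendsto_const_nhds

theorem analyticAt_det {𝕜 : Type*} [NontriviallyNormedField 𝕜] {F : Type*} [NormedAddCommGroup F]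
    [NormedSpace 𝕜 F] {ι : Type*} [Fintype ι] [DecidableEq ι] {A : F → Matrix ι ι 𝕜} {x : F}
    (hA : ∀ i j, AnalyticAt 𝕜 (fun y => A y i j) x) : AnalyticAt 𝕜 (fun y => (A y).det) x := by
  simp only [Matrix.det_apply']
  refine Finset.analyticAt_fun_sum _ fun s _ => ?_
  exact analyticAt_const.mul (Finset.analyticAt_fun_prod _ fun i _ => hA _ _)

theorem ae_ne_zero_of_analyticAt {F : ℝ → ℝ} (hF : ∀ t, AnalyticAt ℝ F t) {t₀ : ℝ}
    (h : F t₀ ≠ 0) : ∀ᵐ t : ℝ, F t ≠ 0 := by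
  have h1 : F ⁻¹' {0}ᶜ ∈ codiscrete ℝ :=
    AnalyticOnNhd.preimage_zero_mem_codiscrete (fun t _ => hF t) h
  have h2 := ae_restrict_le_codiscreteWithin (μ := (volume : Measure ℝ)) MeasurableSet.univ h1
  rw [Measure.restrict_univ] at h2
  exact h2

variable [NormedSpace ℝ E]

theorem analyticAt_det_collocationMatrix_cons (hf : ∀ x ≠ 0, AnalyticAt ℝ f x)
    (hg : ∀ x ≠ 0, AnalyticAt ℝ g x) (p : Fin n → E) {x : E} (hx : ∀ b, x ≠ Sum.elim p Q b) :
    AnalyticAt ℝ (fun x => (collocationMatrix f g (Fin.cons x p : Fin (n + 1) → E) Q).det) x := by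
  have h1 {k : E → ℝ} (hk : ∀ x ≠ 0, AnalyticAt ℝ k x) (b) :
      AnalyticAt ℝ (fun y => k (y - Sum.elim p Q b)) x :=
    (hk _ (sub_ne_zero.2 (hx b))).fun_comp (f := fun y => y - Sum.elim p Q b) (by fun_prop)
  have h2 {k : E → ℝ} (hk : ∀ x ≠ 0, AnalyticAt ℝ k x) (b) :
      AnalyticAt ℝ (fun y => k (Sum.elim p Q b - y)) x :=
    (hk _ (sub_ne_zero.2 (hx b).symm)).fun_comp (f := fun y => Sum.elim p Q b - y) (by fun_prop)
  simp only [det_collocationMatrix_cons]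
  refine analyticAt_det fun a b => ?_
  rcases a with a | a | a <;> rcases b with b | b
  · exact analyticAt_const
  · exact h1 hg b
  · exact h2 hg (Sum.inl a)
  · exact analyticAt_const
  · exact h2 hf (Sum.inr a)
  · exact analyticAt_const

variable [MeasurableSpace E] [BorelSpace E] [FiniteDimensional ℝ E]

theorem measurable_det_collocationMatrix (hf : Measurable f) (hg : Measurable g) (n : ℕ) :
    Measurable fun p : Fin n → E => (collocationMatrix f g p Q).det := by
  simp only [Matrix.det_apply', collocationMatrix, Matrix.of_apply]
  refine Finset.measurable_fun_sum _ fun s _ =>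
    (Finset.measurable_fun_prod _ fun b _ => ?_).const_mul _
  have hb : Measurable fun p : Fin n → E => Sum.elim p Q b := by
    rcases b with b | b
    · exact measurable_pi_apply b
    · exact measurable_const
  rcases s b with a | a
  · exact hg.comp ((measurable_pi_apply a).sub hb)
  · exact hf.comp (measurable_const.sub hb)

theorem ae_det_collocationMatrix_cons_ne_zero (hd : 2 ≤ Module.finrank ℝ E)
    (ν : Measure E) [ν.IsAddHaarMeasure]
    (hfm : Measurable f) (hgm : Measurable g)
    (hf : ∀ x ≠ 0, AnalyticAt ℝ f x) (hg : ∀ x ≠ 0, AnalyticAt ℝ g x)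
    (hfl : Tendsto f (Bornology.cobounded E) (𝓝 0))
    (hgl : Tendsto g (Bornology.cobounded E) (𝓝 0)) (hg0 : g 0 ≠ 0)
    {p : Fin n → E} (hp : (collocationMatrix f g p Q).det ≠ 0) :
    ∀ᵐ x ∂ν, (collocationMatrix f g (Fin.cons x p : Fin (n + 1) → E) Q).det ≠ 0 := by
  set D : E → ℝ := fun x => (collocationMatrix f g (Fin.cons x p : Fin (n + 1) → E) Q).det
  have hDm : Measurable D :=
    (measurable_det_collocationMatrix hfm hgm (n + 1)).comp
      (measurable_pi_iff.2 fun i => Fin.cases (by simpa using! measurable_id) (fun j => by simp) i)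
  have : Nontrivial E := Module.nontrivial_of_finrank_pos (R := ℝ) (by omega)
  obtain ⟨v, hv⟩ := exists_ne (0 : E)
  -- The lines of direction `v` through the old centres; they are null because the dimension is at
  -- least two.
  let N : Set E := ⋃ b, (AffineSubspace.mk' (Sum.elim p Q b) (ℝ ∙ v) : Set E)
  have hNc : IsClosed N := isClosed_iUnion_of_finite fun b =>
    AffineSubspace.closed_of_finiteDimensional _
  have hN0 : ν N = 0 := by
    refine measure_iUnion_null fun b => Measure.addHaar_affineSubspace ν _ fun htop => ?_
    have h1 := congrArg AffineSubspace.direction htop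
    rw [AffineSubspace.direction_mk', AffineSubspace.direction_top] at h1
    have h2 := finrank_span_singleton (K := ℝ) hv
    rw [h1, finrank_top] at h2
    omega
  -- The slicing lemma wants every line, not almost every one; adjoining `N` makes the lines through
  -- centres trivial.
  have key : ∀ᵐ x ∂ν, x ∈ {x | D x ≠ 0} ∪ N := by
    refine ae_mem_of_ae_add_linearMap_mem (LinearMap.toSpanSingleton ℝ E v) volume ν
      ((measurableSet_eq_fun hDm measurable_const).compl.union hNc.measurableSet) fun y => ?_
    by_cases hy : y ∈ N
    · refine Eventually.of_forall fun t => Or.inr ?_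
      obtain ⟨b, hb⟩ := Set.mem_iUnion.1 hy
      refine Set.mem_iUnion.2 ⟨b, ?_⟩
      have hb' : y -ᵥ Sum.elim p Q b ∈ ℝ ∙ v := hb
      change y + t • v - Sum.elim p Q b ∈ ℝ ∙ v
      rw [add_sub_right_comm]
      exact add_mem hb' (Submodule.smul_mem _ _ (Submodule.mem_span_singleton_self v))
    · have hline (t : ℝ) (b) : y + t • v ≠ Sum.elim p Q b := by
        intro h
        refine hy (Set.mem_iUnion.2 ⟨b, ?_⟩)
        change y - Sum.elim p Q b ∈ ℝ ∙ v
        rw [← h, sub_add_cancel_left]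
        exact neg_mem (Submodule.smul_mem _ _ (Submodule.mem_span_singleton_self v))
      have hlim : Tendsto (fun t : ℝ => y + t • v) atTop (Bornology.cobounded E) := by
        rw [← tendsto_norm_atTop_iff_cobounded]
        refine tendsto_atTop_mono (f := fun t : ℝ => t * ‖v‖ - ‖y‖) (fun t => ?_)
          (tendsto_atTop_add_const_right _ _ (tendsto_id.atTop_mul_const (norm_pos_iff.2 hv)))
        have h1 := norm_sub_le (y + t • v) y
        rw [add_sub_cancel_left, norm_smul, Real.norm_eq_abs] at h1
        nlinarith [le_abs_self t, norm_nonneg v]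
      have hev := ((tendsto_det_collocationMatrix_cons (Q := Q) hfl hgl p).comp hlim).eventually_ne
        (mul_ne_zero hg0 hp)
      obtain ⟨t₀, ht₀⟩ := hev.exists
      refine (ae_ne_zero_of_analyticAt (F := fun t => D (y + t • v)) (fun t => ?_) ht₀).mono
        fun t ht => Or.inl ht
      exact (analyticAt_det_collocationMatrix_cons hf hg p (hline t)).fun_comp
        (f := fun t : ℝ => y + t • v) (by fun_prop)
  have hN : ∀ᵐ x ∂ν, x ∉ N := measure_eq_zero_iff_ae_notMem.1 hN0
  filter_upwards [key, hN] with x hx hxN using hx.resolve_right hxN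

theorem ae_det_collocationMatrix_ne_zero (hd : 2 ≤ Module.finrank ℝ E)
    (ν : Measure E) [ν.IsAddHaarMeasure] (ρ : Measure E) [SigmaFinite ρ] (hρ : ρ ≪ ν)
    (hfm : Measurable f) (hgm : Measurable g)
    (hf : ∀ x ≠ 0, AnalyticAt ℝ f x) (hg : ∀ x ≠ 0, AnalyticAt ℝ g x)
    (hfl : Tendsto f (Bornology.cobounded E) (𝓝 0))
    (hgl : Tendsto g (Bornology.cobounded E) (𝓝 0)) (hg0 : g 0 ≠ 0)
    (hQ : (Matrix.of fun h k => f (Q h - Q k)).det ≠ 0) (n : ℕ) :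
    ∀ᵐ p ∂Measure.pi (fun _ : Fin n => ρ), (collocationMatrix f g p Q).det ≠ 0 := by
  induction n with
  | zero =>
    refine Eventually.of_forall fun p => ?_
    rwa [← Matrix.det_submatrix_equiv_self (Equiv.emptySum (Fin 0) κ).symm]
  | succ n ih =>
    have hmp := (measurePreserving_piFinSuccAbove (fun _ : Fin (n + 1) => ρ) 0).symm
    have hms : MeasurableSet {p : Fin (n + 1) → E | (collocationMatrix f g p Q).det ≠ 0} :=
      (measurableSet_eq_fun (measurable_det_collocationMatrix hfm hgm _) measurable_const).compl
    rw [← hmp.map_eq, ae_map_iff hmp.measurable.aemeasurable hms]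
    have hm : MeasurableSet {z : E × (Fin n → E) |
        (collocationMatrix f g (Fin.cons z.1 z.2 : Fin (n + 1) → E) Q).det ≠ 0} := by
      refine (measurableSet_eq_fun ((measurable_det_collocationMatrix hfm hgm (n + 1)).comp ?_)
        measurable_const).compl
      exact measurable_pi_iff.2 fun i => Fin.cases (by simpa using! measurable_fst)
        (fun j => by simpa using! (measurable_pi_apply j).comp measurable_snd) i
    have h1 : ∀ᵐ z ∂ρ.prod (Measure.pi fun _ : Fin n => ρ),
        (collocationMatrix f g (Fin.cons z.1 z.2 : Fin (n + 1) → E) Q).det ≠ 0 := by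
      -- After the swap, the old points are fixed first and the new point varies.
      rw [Measure.ae_prod_iff_ae_ae hm, Measure.ae_ae_comm hm]
      exact ih.mono fun p hp => hρ.ae_le
        (ae_det_collocationMatrix_cons_ne_zero hd ν hfm hgm hf hg hfl hgl hg0 hp)
    exact h1.mono fun z hz => by simpa [Fin.insertNthEquiv] using! hz

end Collocation

/-! ### From collocation matrices to the Kansa matrix. -/

section Kansa

open Filter Topology

theorem laplacian_comp_sub {E : Type*} [NormedAddCommGroup E] [InnerProductSpace ℝ E]
    [FiniteDimensional ℝ E] (f : E → ℝ) (a x : E) :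
    Laplacian.laplacian (fun y => f (y - a)) x = Laplacian.laplacian f (x - a) := by
  simp only [InnerProductSpace.laplacian_eq_iteratedFDeriv_stdOrthonormalBasis,
    iteratedFDeriv_comp_sub]

theorem ae_det_kansaMatrix_ne_zero_of_eq_gaussianMixture {d : ℕ} (hd : 2 ≤ d)
    {Ω : Type*} [MeasurableSpace Ω] {X : Ω → ℝ} {γ : Measure Ω} [IsFiniteMeasure γ] (hγ : γ ≠ 0)
    (hXm : Measurable X) (hX : ∀ᵐ ω ∂γ, 0 < X ω) (hXi : Integrable X γ)
    {φ : ℝ → ℝ} {ε : ℝ} (hφ : ∀ r, 0 ≤ r → φ (ε * r) = ∫ ω, Real.exp (-r ^ 2 * X ω) ∂γ)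
    {κ : ℕ} {Q : Fin κ → EuclideanSpace ℝ (Fin d)} (hQ : Function.Injective Q)
    {S : Type*} [MeasurableSpace S] {μ : Measure S} [IsProbabilityMeasure μ]
    {P : ℕ → S → EuclideanSpace ℝ (Fin d)} (hP_meas : ∀ i, Measurable (P i))
    (hP_indep : iIndepFun P μ) {ρ : Measure (EuclideanSpace ℝ (Fin d))} (hρ : ρ ≪ volume)
    (hP_law : ∀ i, μ.map (P i) = ρ) (n : ℕ) :
    ∀ᵐ s ∂μ, (kansaMatrix φ ε (fun i : Fin n => P i s) Q).det ≠ 0 := by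
  set f : EuclideanSpace ℝ (Fin d) → ℝ := gaussianMixture X γ with hf
  have hrbf (A) : rbf φ ε A = fun x => f (x - A) := funext fun x => by
    simp [rbf, hφ _ (norm_nonneg _), hf, gaussianMixture, laplaceMoment]
  have hK (p : Fin n → EuclideanSpace ℝ (Fin d)) :
      kansaMatrix φ ε p Q = collocationMatrix f (Laplacian.laplacian f) p Q := by
    ext (_ | _) (_ | _) <;> simp [kansaMatrix, collocationMatrix, hrbf, laplacian_comp_sub]
  have hfin : 2 ≤ Module.finrank ℝ (EuclideanSpace ℝ (Fin d)) := by simpa using hd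
  have : Nontrivial (EuclideanSpace ℝ (Fin d)) :=
    Module.nontrivial_of_finrank_pos (R := ℝ) (by omega)
  have : IsProbabilityMeasure ρ := hP_law 0 ▸
    Measure.isProbabilityMeasure_map (hP_meas 0).aemeasurable
  have h := ae_det_collocationMatrix_ne_zero (Q := Q) hfin volume ρ hρ
    (measurable_gaussianMixture hXm) (measurable_laplacian_gaussianMixture hXm hX hXi)
    (fun x hx => analyticAt_gaussianMixture hXm hX hx)
    (fun x hx => analyticAt_laplacian_gaussianMixture hXm hX hXi hx)
    (tendsto_gaussianMixture_cobounded hXm hX)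
    (tendsto_laplacian_gaussianMixture_cobounded hXm hX hXi)
    (laplacian_gaussianMixture_zero_ne hγ hXm hX hXi)
    (det_gaussianMixture_ne_zero hγ hXm hX hQ) n
  have hlaw : μ.map (fun s (i : Fin n) => P i s) = Measure.pi fun _ : Fin n => ρ := by
    have h1 := (iIndepFun_iff_map_fun_eq_pi_map fun i : Fin n => (hP_meas i).aemeasurable).1
      (hP_indep.precomp Fin.val_injective)
    simpa only [hP_law] using h1
  rw [← hlaw] at h
  simpa only [hK] using ae_of_ae_map
    (measurable_pi_iff.2 fun i : Fin n => hP_meas i).aemeasurable h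

end Kansa

/-! ### Inverse multiquadrics and Matérn functions as Gamma mixtures. -/

section GammaMixture

open Real Set

theorem measurable_gammaPDF (a r : ℝ) : Measurable (gammaPDF a r) :=
  (measurable_gammaPDFReal a r).ennreal_ofReal

theorem ae_gammaMeasure_pos (a : ℝ) : ∀ᵐ t ∂gammaMeasure a 1, 0 < t := by
  rw [gammaMeasure, ae_withDensity_iff (measurable_gammaPDF a 1)]
  filter_upwards [Measure.ae_ne volume (0 : ℝ)] with t ht h
  by_contra hlt
  exact h (gammaPDF_of_neg (lt_of_le_of_ne (not_lt.1 hlt) ht))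

theorem gammaPDFReal_smul_eq_indicator (a : ℝ) (F : ℝ → ℝ) :
    (fun t => gammaPDFReal a 1 t • F t) =
      (Ici 0).indicator fun t => (Gamma a)⁻¹ * (t ^ (a - 1) * exp (-t) * F t) := by
  ext t
  by_cases ht : 0 ≤ t
  · simp [gammaPDFReal, ht, mul_assoc]
  · simp [gammaPDFReal, ht]

theorem integral_gammaMeasure {a : ℝ} (ha : 0 < a) (F : ℝ → ℝ) :
    ∫ t, F t ∂gammaMeasure a 1 =
      (Gamma a)⁻¹ * ∫ t in Ioi 0, t ^ (a - 1) * exp (-t) * F t := by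
  rw [gammaMeasure, integral_withDensity_eq_integral_toReal_smul
    (measurable_gammaPDF a 1) (ae_of_all _ fun _ => ENNReal.ofReal_lt_top)]
  simp only [gammaPDF, ENNReal.toReal_ofReal (gammaPDFReal_nonneg ha one_pos _)]
  rw [gammaPDFReal_smul_eq_indicator, integral_indicator measurableSet_Ici,
    integral_Ici_eq_integral_Ioi, integral_const_mul]

theorem integrable_gammaMeasure {a : ℝ} (ha : 0 < a) {F : ℝ → ℝ}
    (hF : IntegrableOn (fun t => t ^ (a - 1) * exp (-t) * F t) (Ioi 0)) :
    Integrable F (gammaMeasure a 1) := by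
  rw [gammaMeasure, integrable_withDensity_iff_integrable_smul' (measurable_gammaPDF a 1)
    (ae_of_all _ fun _ => ENNReal.ofReal_lt_top)]
  simp only [gammaPDF, ENNReal.toReal_ofReal (gammaPDFReal_nonneg ha one_pos _)]
  rw [gammaPDFReal_smul_eq_indicator, integrable_indicator_iff measurableSet_Ici,
    integrableOn_Ici_iff_integrableOn_Ioi]
  exact hF.const_mul _

theorem integrable_id_gammaMeasure {a : ℝ} (ha : 0 < a) :
    Integrable (fun t => t) (gammaMeasure a 1) := by
  refine integrable_gammaMeasure ha ((GammaIntegral_convergent (s := a + 1)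
    (by positivity)).congr_fun (fun t ht => ?_) measurableSet_Ioi)
  have ht' : t ≠ 0 := ne_of_gt ht
  simp only [add_sub_cancel_right, rpow_sub_one ht']
  field_simp

/-- The integral is that of `Γ(a - 1)`; this is the source of the condition `ν > 1` in the Matérn
case. -/
theorem integrable_inv_gammaMeasure {a : ℝ} (ha : 1 < a) :
    Integrable (fun t => t⁻¹) (gammaMeasure a 1) := by
  refine integrable_gammaMeasure (by linarith) ((GammaIntegral_convergent (s := a - 1)
    (by linarith)).congr_fun (fun t ht => ?_) measurableSet_Ioi)
  have ht' : t ≠ 0 := ne_of_gt ht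
  simp only [rpow_sub_one ht']
  field_simp

theorem gimqRBF_eq_integral {β : ℝ} (hβ : β < 0) (ε r : ℝ) :
    gimqRBF β (ε * r) = ∫ t, exp (-r ^ 2 * (ε ^ 2 * t)) ∂gammaMeasure (-β) 1 := by
  have hb : 0 < -β := neg_pos.2 hβ
  have hs : 0 < 1 + (ε * r) ^ 2 := by positivity
  rw [integral_gammaMeasure hb]
  have h : ∫ t in Ioi (0 : ℝ), t ^ (-β - 1) * exp (-t) * exp (-r ^ 2 * (ε ^ 2 * t)) =
      ∫ t in Ioi (0 : ℝ), t ^ (-β - 1) * exp (-((1 + (ε * r) ^ 2) * t)) := by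
    congr 1 with t
    rw [mul_assoc, ← exp_add]
    congr 2
    ring
  rw [h, integral_rpow_mul_exp_neg_mul_Ioi hb hs, gimqRBF, one_div, inv_rpow hs.le,
    rpow_neg hs.le, inv_inv]
  field_simp [(Gamma_pos_of_pos hb).ne']

theorem image_const_mul_exp_univ {c : ℝ} (hc : 0 < c) : (fun x => c * exp x) '' univ = Ioi 0 := by
  ext t
  simp only [image_univ, mem_range, mem_Ioi]
  refine ⟨by rintro ⟨x, rfl⟩; positivity, fun ht => ⟨log (t / c), ?_⟩⟩
  rw [exp_log (by positivity)]
  field_simp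

theorem integrableOn_rpow_mul_exp_mul_exp_inv {ν : ℝ} (hν : 0 < ν) {b : ℝ} (hb : 0 ≤ b) :
    IntegrableOn (fun t => t ^ (ν - 1) * exp (-t) * exp (-b * t⁻¹)) (Ioi 0) := by
  refine Integrable.mono' (GammaIntegral_convergent hν) (by fun_prop) ?_
  filter_upwards [ae_restrict_mem measurableSet_Ioi] with t ht
  have ht : 0 < t := ht
  rw [norm_of_nonneg (by positivity), mul_comm (exp (-t))]
  exact mul_le_of_le_one_right (by positivity) (exp_neg_mul_le_one hb (by positivity))

/-- Substitute `t = (r/2) exp x`, so that `t + r²/(4t) = r cosh x`, then fold the real line at `0`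
to turn `exp(ν x)` into `2 cosh(ν x)`. -/
theorem besselK_eq_integral {ν r : ℝ} (hν : 0 < ν) (hr : 0 < r) :
    ∫ t in Ioi 0, t ^ (ν - 1) * exp (-t) * exp (-(r ^ 2 / 4) * t⁻¹) =
      2 * (r / 2) ^ ν * besselK ν r := by
  have hr2 : 0 < r / 2 := by positivity
  have hderiv (x : ℝ) : HasDerivWithinAt (fun x => r / 2 * exp x) (r / 2 * exp x) univ x :=
    ((hasDerivAt_exp x).const_mul _).hasDerivWithinAt
  have hinj : InjOn (fun x => r / 2 * exp x) univ := fun x _ y _ h =>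
    exp_injective (mul_left_cancel₀ hr2.ne' h)
  have hint := integrableOn_rpow_mul_exp_mul_exp_inv hν (b := r ^ 2 / 4) (by positivity)
  have hpt (x : ℝ) : |r / 2 * exp x| • ((r / 2 * exp x) ^ (ν - 1) * exp (-(r / 2 * exp x)) *
      exp (-(r ^ 2 / 4) * (r / 2 * exp x)⁻¹)) =
      (r / 2) ^ ν * (exp (ν * x) * exp (-r * cosh x)) := by
    have h0 : 0 < r / 2 * exp x := by positivity
    rw [abs_of_pos h0, rpow_sub_one h0.ne', mul_rpow hr2.le (exp_pos x).le, ← exp_mul, cosh_eq,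
      exp_neg x, mul_comm x ν, smul_eq_mul, mul_assoc _ (exp (-_)), ← exp_add]
    have h1 : -(r / 2 * exp x) + -(r ^ 2 / 4) * (r / 2 * exp x)⁻¹ =
        -r * ((exp x + (exp x)⁻¹) / 2) := by
      field_simp
      ring
    rw [h1]
    field_simp
  rw [← image_const_mul_exp_univ hr2] at hint ⊢
  rw [integrableOn_image_iff_integrableOn_abs_deriv_smul MeasurableSet.univ
    (fun x _ => hderiv x) hinj] at hint
  rw [integral_image_eq_integral_abs_deriv_smul MeasurableSet.univ (fun x _ => hderiv x) hinj]
  simp only [hpt, integrableOn_univ, setIntegral_univ] at hint ⊢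
  have hint' : Integrable fun x => exp (ν * x) * exp (-r * cosh x) := by
    have := hint.const_mul ((r / 2) ^ ν)⁻¹
    simpa only [inv_mul_cancel_left₀ (rpow_pos_of_pos hr2 ν).ne'] using this
  rw [integral_const_mul, ← intervalIntegral.integral_Iic_add_Ioi (b := 0) hint'.integrableOn
    hint'.integrableOn, ← neg_zero, ← integral_comp_neg_Ioi, neg_zero,
    ← integral_add hint'.comp_neg.integrableOn hint'.integrableOn, besselK,
    mul_comm 2, mul_assoc]
  congr 1
  rw [← integral_const_mul]
  refine setIntegral_congr_fun measurableSet_Ioi fun x _ => ?_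
  rw [cosh_neg, cosh_eq (ν * x), mul_neg]
  ring

theorem maternRBF_eq_integral {ν ε : ℝ} (hν : 1 < ν) (hε : 0 < ε) {r : ℝ} (hr : 0 ≤ r) :
    maternRBF ν (ε * r) = ∫ t, exp (-r ^ 2 * (ε ^ 2 / 4 * t⁻¹)) ∂gammaMeasure ν 1 := by
  have hν0 : 0 < ν := by linarith
  have := isProbabilityMeasure_gammaMeasure hν0 one_pos
  rcases hr.eq_or_lt with rfl | hr
  · simp [maternRBF]
  have hs : 0 < ε * r := by positivity
  have h := besselK_eq_integral hν0 hs
  have hexp (t : ℝ) : -r ^ 2 * (ε ^ 2 / 4 * t⁻¹) = -((ε * r) ^ 2 / 4) * t⁻¹ := by ring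
  simp only [hexp]
  rw [integral_gammaMeasure hν0, h, maternRBF, if_neg hs.ne', div_rpow hs.le zero_le_two,
    rpow_sub two_pos, rpow_one]
  field_simp

end GammaMixture

/-! ### The three families of kernels. -/

theorem mainTheorem2 {d : ℕ} (hd : 2 ≤ d)
    -- the bounded domain
    (U : Set (EuclideanSpace ℝ (Fin d)))
    (hU_open : IsOpen U) (hU_conn : IsConnected U) (hU_bdd : Bornology.IsBounded U)
    -- the fixed distinct boundary points
    {m : ℕ} (hm : 1 ≤ m) (Q : Fin m → EuclideanSpace ℝ (Fin d))
    (hQ_inj : Function.Injective Q) (hQ : ∀ h, Q h ∈ frontier U)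
    -- the probability density on the domain
    (σ : EuclideanSpace ℝ (Fin d) → ℝ)
    (hσ_nonneg : ∀ᵐ x ∂(volume.restrict U), 0 ≤ σ x)
    (hσ_int : IntegrableOn σ U volume) (hσ_one : ∫ x in U, σ x = 1)
    -- the i.i.d. random interior points, with density `σ` on the domain
    {S : Type*} [MeasurableSpace S] (μ : Measure S) [IsProbabilityMeasure μ]
    (P : ℕ → S → EuclideanSpace ℝ (Fin d))
    (hP_meas : ∀ i, Measurable (P i)) (hP_indep : iIndepFun P μ)
    (hP_law : ∀ i, μ.map (P i) =
      (volume.restrict U).withDensity (fun x => ENNReal.ofReal (σ x)))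
    -- the shape parameter
    {ε : ℝ} (hε : 0 < ε) :
    (∀ n : ℕ, ∀ᵐ s ∂μ,
      (kansaMatrix gaussianRBF ε (fun i : Fin n => P i s) Q).det ≠ 0) ∧
    (∀ β : ℝ, β < 0 → ∀ n : ℕ, ∀ᵐ s ∂μ,
      (kansaMatrix (gimqRBF β) ε (fun i : Fin n => P i s) Q).det ≠ 0) ∧
    (∀ ν : ℝ, 1 < ν → ∀ n : ℕ, ∀ᵐ s ∂μ,
      (kansaMatrix (maternRBF ν) ε (fun i : Fin n => P i s) Q).det ≠ 0) := by
  have hρ : (volume.restrict U).withDensity (fun x => ENNReal.ofReal (σ x)) ≪ volume :=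
    (withDensity_absolutelyContinuous _ _).trans Measure.absolutelyContinuous_restrict
  refine ⟨?_, fun β hβ => ?_, fun ν hν => ?_⟩
  · exact ae_det_kansaMatrix_ne_zero_of_eq_gaussianMixture hd (γ := Measure.dirac ())
      (X := fun _ => ε ^ 2) (NeZero.ne _) measurable_const
      (Filter.Eventually.of_forall fun _ => by positivity) (integrable_const _)
      (fun r _ => by simp [gaussianRBF, mul_pow, mul_comm]) hQ_inj hP_meas hP_indep hρ hP_law
  · have := isProbabilityMeasure_gammaMeasure (neg_pos.2 hβ) one_pos
    exact ae_det_kansaMatrix_ne_zero_of_eq_gaussianMixture hd (γ := gammaMeasure (-β) 1)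
      (X := fun t => ε ^ 2 * t) (NeZero.ne _) (by fun_prop)
      ((ae_gammaMeasure_pos _).mono fun t ht => by positivity)
      ((integrable_id_gammaMeasure (neg_pos.2 hβ)).const_mul _)
      (fun r _ => gimqRBF_eq_integral hβ ε r) hQ_inj hP_meas hP_indep hρ hP_law
  · have := isProbabilityMeasure_gammaMeasure (by linarith : 0 < ν) one_pos
    exact ae_det_kansaMatrix_ne_zero_of_eq_gaussianMixture hd (γ := gammaMeasure ν 1)
      (X := fun t => ε ^ 2 / 4 * t⁻¹) (NeZero.ne _) (by fun_prop)
      ((ae_gammaMeasure_pos _).mono fun t ht => by positivity)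
      ((integrable_inv_gammaMeasure hν).const_mul _)
      (fun r hr => maternRBF_eq_integral hν hε hr) hQ_inj hP_meas hP_indep hρ hP_law
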